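/- Let $L$ be a link in $\mathbb{R}^3$, that is, a finite disjoint union of smoothly embedded circles, considered up to ambient isotopy. $L$ is called splittable if an ambient isotopy moves it off some plane so that points of the link lie on both sides of that plane. A $\mathbb{Z}$-coloring of a regular diagram $D$ of $L$ is a map $\gamma$ from the set of arcs of $D$ to $\mathbb{Z}$ such that $2\gamma(a)=\gamma(b)+\gamma(c)$ at each crossing of $D$ with over arc $a$ and under arcs $b$ and $c$. We say that $L$ admits a $\mathbb{Z}$-coloring with image $S\subset\mathbb{Z}$ if some regular diagram of $L$ has a $\mathbb{Z}$-coloring $\gamma$ with $\mathrm{Im}(\gamma)=S$. Theorem. Suppose that $L$ is non-splittable and admits a $\mathbb{Z}$-coloring with exactly five colors, that is, with an image of cardinality $5$ (so that $L$ is $\mathbb{Z}$-colorable, i.e. some diagram of $L$ has a non-constant $\mathbb{Z}$-coloring). Then $L$ admits a $\mathbb{Z}$-coloring whose image is one of $\{0,1,2,3,4\}$, $\{0,1,2,3,5\}$, $\{0,1,2,3,6\}$, $\{0,1,2,4,7\}$, $\{0,2,3,4,5\}$, $\{0,3,4,5,6\}$ or $\{0,3,5,6,7\}$. -/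

import Mathlib

open scoped ContDiff Topology

namespace KnotTheory

/-- Three-dimensional space, written as (plane) × (height). Only its smooth structure is used.
Diagrams are obtained by the vertical projection `Prod.fst` to the plane, and `Prod.snd` is the
height, which decides which strand of a crossing is the over strand. -/
abbrev Space : Type := (ℝ × ℝ) × ℝ

/-- A (smooth, tame) link in three-dimensional space: finitely many disjoint smoothly embedded
circles, given by regular parametrizations of period `1`. -/
structure Link where
  /-- the number of components -/
  numComp : ℕ
  /-- the parametrizations of the components -/
  curve : Fin numComp → ℝ → Space
  periodic : ∀ i t, curve i (t + 1) = curve i t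
  smooth : ∀ i, ContDiff ℝ ∞ (curve i)
  immersed : ∀ i t, deriv (curve i) t ≠ 0
  injective : ∀ i j s t, curve i s = curve j t → i = j ∧ ∃ k : ℤ, s = t + k

/-- A smooth ambient isotopy of three-dimensional space: a smooth family of diffeomorphisms
starting at the identity (time is extended from `[0, 1]` to the real line). -/
structure AmbientIsotopy where
  toFun : ℝ → Space → Space
  invFun : ℝ → Space → Space
  smooth_toFun : ContDiff ℝ ∞ (fun p : ℝ × Space => toFun p.1 p.2)
  smooth_invFun : ContDiff ℝ ∞ (fun p : ℝ × Space => invFun p.1 p.2)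
  left_inv : ∀ t x, invFun t (toFun t x) = x
  right_inv : ∀ t x, toFun t (invFun t x) = x
  at_zero : ∀ x, toFun 0 x = x

namespace Link

/-- The link as a subset of space. -/
def carrier (L : Link) : Set Space := {p | ∃ i t, L.curve i t = p}

/-- `L` and `K` are equivalent as unoriented links: an ambient isotopy moves `L` onto `K`. -/
def Isotopic (L K : Link) : Prop :=
  ∃ H : AmbientIsotopy, H.toFun 1 '' L.carrier = K.carrier

/-- `L` is splittable: an ambient isotopy moves it off a plane in such a way that there are
points of the link on both sides of that plane. -/
def Splittable (L : Link) : Prop :=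
  ∃ H : AmbientIsotopy,
    (∀ p ∈ L.carrier, (H.toFun 1 p).2 ≠ 0) ∧
    (∃ p ∈ L.carrier, 0 < (H.toFun 1 p).2) ∧
    (∃ p ∈ L.carrier, (H.toFun 1 p).2 < 0)

/-- The crossing points on the lower strand: those points of the link that lie vertically below
another point of the link. -/
def under (K : Link) : Set Space :=
  {p | p ∈ K.carrier ∧ ∃ q ∈ K.carrier, q.1 = p.1 ∧ p.2 < q.2}

/-- `K` is in regular position: the vertical projection restricted to `K` is an immersion with
finitely many multiple points, all of which are transverse double points. Such a `K` represents
a regular diagram (the projection, with over/under information), and every regular diagram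
arises in this way. -/
structure IsRegular (K : Link) : Prop where
  immersed : ∀ i t, deriv (fun s => (K.curve i s).1) t ≠ 0
  finite_crossings : K.under.Finite
  no_triple : ∀ p ∈ K.carrier, ∀ q ∈ K.carrier, ∀ r ∈ K.carrier,
    p.1 = q.1 → q.1 = r.1 → p = q ∨ q = r ∨ p = r
  transverse : ∀ i j s t, (K.curve i s).1 = (K.curve j t).1 → K.curve i s ≠ K.curve j t →
    LinearIndependent ℝ
      ![deriv (fun u => (K.curve i u).1) s, deriv (fun u => (K.curve j u).1) t]

/-- `K` represents a regular diagram of the link `L`. -/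
def IsDiagramOf (K L : Link) : Prop := K.IsRegular ∧ L.Isotopic K

/-- The link cut at the lower point of each crossing. -/
abbrev Cut (K : Link) : Type := ↥(K.carrier \ K.under)

/-- The arcs of the diagram: the pieces into which the link falls when it is cut at the lower
point of each crossing. -/
abbrev Arc (K : Link) : Type := ConnectedComponents K.Cut

/-- The arc on which a point lies. -/
def arcOf (K : Link) (x : K.Cut) : K.Arc := ConnectedComponents.mk x

/-- `a` is the arc running along component `i` immediately after the parameter `t`. -/
def IsArcAfter (K : Link) (i : Fin K.numComp) (t : ℝ) (a : K.Arc) : Prop :=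
  ∀ᶠ s in 𝓝[>] t, ∃ h : K.curve i s ∈ K.carrier \ K.under, K.arcOf ⟨K.curve i s, h⟩ = a

/-- `a` is the arc running along component `i` immediately before the parameter `t`. -/
def IsArcBefore (K : Link) (i : Fin K.numComp) (t : ℝ) (a : K.Arc) : Prop :=
  ∀ᶠ s in 𝓝[<] t, ∃ h : K.curve i s ∈ K.carrier \ K.under, K.arcOf ⟨K.curve i s, h⟩ = a

/-- `γ` is a `ℤ`-coloring of the diagram `K`: at each crossing, with lower point `K.curve i t`,
upper point `q`, and under arcs `b` and `c` (the arcs on the two sides of the lower point), twice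
the color of the over arc is the sum of the colors of the under arcs. -/
def IsZColoring (K : Link) (γ : K.Arc → ℤ) : Prop :=
  ∀ (i : Fin K.numComp) (t : ℝ) (q : K.Cut),
    (q : Space).1 = (K.curve i t).1 → (K.curve i t).2 < (q : Space).2 →
    ∀ b c : K.Arc, K.IsArcBefore i t b → K.IsArcAfter i t c →
      2 * γ (K.arcOf q) = γ b + γ c

/-- The link `L` admits a `ℤ`-coloring (on some diagram of `L`) whose image is `S`. -/
def AdmitsZColoring (L : Link) (S : Set ℤ) : Prop :=
  ∃ K : Link, K.IsDiagramOf L ∧ ∃ γ : K.Arc → ℤ, K.IsZColoring γ ∧ Set.range γ = S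

end Link

end KnotTheory

/-! Non-splittability becomes arithmetic of the color set. If the image `S` were not
progression-linked, some proper part `T` would force both other colors into `T` at every crossing
having an under arc colored in `T`. Each component would then have all its colors in `T` or none,
and the former components would pass above the latter; a smooth graph between them, flattened by a
vertical shear, splits the link (`splittable_of_above`).

For the arithmetic, subtract a base point and divide by the largest common power of 2. The parity
classes are nonempty, and the ends of a progression share a class. Linkedness at singletons excludes
one-element classes, so five colors split as 2 + 3. Linkedness at the two classes and at singletons
then leaves few linear systems, all solved by the normalized sets up to an affine map. Such a map
can be undone on the coloring itself, without changing the diagram. -/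

/-! ### Arithmetic of five-element progression-linked sets -/

/-- Every nonempty proper part `T` of `S` contains an end of a three-term progression in `S`
that is not contained in `T`. -/
def ProgressionLinked (S : Set ℤ) : Prop :=
  ∀ T : Set ℤ, (∃ s ∈ S, s ∈ T) → (∃ s ∈ S, s ∉ T) →
    ∃ a ∈ S, ∃ b ∈ S, ∃ c ∈ S, 2 * a = b + c ∧ b ∈ T ∧ ¬ (a ∈ T ∧ c ∈ T)

/-- The seven normalized five-element color sets. -/
def IsNormalizedFive (S : Set ℤ) : Prop :=
  S = {0, 1, 2, 3, 4} ∨ S = {0, 1, 2, 3, 5} ∨ S = {0, 1, 2, 3, 6} ∨ S = {0, 1, 2, 4, 7} ∨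
    S = {0, 2, 3, 4, 5} ∨ S = {0, 3, 4, 5, 6} ∨ S = {0, 3, 5, 6, 7}

/-- `S` is an affine image of one of the seven normalized sets. -/
def IsAffineFive (S : Set ℤ) : Prop :=
  ∃ m k : ℤ, k ≠ 0 ∧ ∃ S₀, IsNormalizedFive S₀ ∧ S = (fun j => m + k * j) '' S₀

/-- Here `p, x, q, y` are consecutive terms 0, 1, 2, 3 of a progression with step `q - x`, so `z`
can only sit at -1, 5 or -3. Negative `k` absorbs reflections, which is why the last three
normalized sets, mirror images of earlier ones, never have to be produced. -/
theorem isAffineFive_of_mid_left {p q x y z : ℤ} (hpq : p + q = 2 * x) (hne : p ≠ q)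
    (hxz : x ≠ z) (hyz : y ≠ z) (h : x + y = 2 * q)
    (hz : z + x = 2 * p ∨ z + x = 2 * q ∨ z + x = 2 * y ∨
      z + y = 2 * p ∨ z + y = 2 * q ∨ z + y = 2 * x) :
    IsAffineFive {p, q, x, y, z} := by
  rcases hz with hz | hz | hz | hz | hz | hz
  · refine ⟨z, q - x, by omega, _, Or.inl rfl, ?_⟩
    simp only [Set.image_insert_eq, Set.image_singleton]
    ext s; simp only [Set.mem_insert_iff, Set.mem_singleton_iff]; omega
  · omega
  · refine ⟨p, q - x, by omega, _, Or.inr (Or.inl rfl), ?_⟩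
    simp only [Set.image_insert_eq, Set.image_singleton]
    ext s; simp only [Set.mem_insert_iff, Set.mem_singleton_iff]; omega
  · refine ⟨y, x - q, by omega, _, Or.inr (Or.inr (Or.inl rfl)), ?_⟩
    simp only [Set.image_insert_eq, Set.image_singleton]
    ext s; simp only [Set.mem_insert_iff, Set.mem_singleton_iff]; omega
  · omega
  · refine ⟨z, q - x, by omega, _, Or.inl rfl, ?_⟩
    simp only [Set.image_insert_eq, Set.image_singleton]
    ext s; simp only [Set.mem_insert_iff, Set.mem_singleton_iff]; omega

/-- With origin `x` and `q = d`, one has `p = -d` and `y + z = 2d`. The options for `y` are `-2d`,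
giving `z = 4d`; `2d`, which forces `z = x`; and `2z`, which gives `3z = 2d`. -/
theorem isAffineFive_of_mid_right {p q x y z : ℤ} (hpq : p + q = 2 * x) (hne : p ≠ q)
    (hxy : x ≠ y) (hxz : x ≠ z) (h : y + z = 2 * q)
    (hx : x + y = 2 * p ∨ x + y = 2 * q ∨ x + y = 2 * z) :
    IsAffineFive {p, q, x, y, z} := by
  rcases hx with hx | hx | hx
  · refine ⟨y, q - x, by omega, _, Or.inr (Or.inr (Or.inl rfl)), ?_⟩
    simp only [Set.image_insert_eq, Set.image_singleton]
    ext s; simp only [Set.mem_insert_iff, Set.mem_singleton_iff]; omega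
  · omega
  · refine ⟨y, z - q, by omega, _, Or.inr (Or.inr (Or.inr (Or.inl rfl))), ?_⟩
    simp only [Set.image_insert_eq, Set.image_singleton]
    ext s; simp only [Set.mem_insert_iff, Set.mem_singleton_iff]; omega

/-- `u` is joined to `v` or to `w` by a progression whose midpoint is one of the other points. -/
def ProgressionJoined (p q u v w : ℤ) : Prop :=
  u + v = 2 * p ∨ u + v = 2 * q ∨ u + v = 2 * w ∨ u + w = 2 * p ∨ u + w = 2 * q ∨ u + w = 2 * v

theorem ProgressionJoined.swap {p q u v w : ℤ} (h : ProgressionJoined p q u v w) : ProgressionJoined p q u w v := by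
  unfold ProgressionJoined at *; omega

theorem ProgressionJoined.swap' {p q u v w : ℤ} (h : ProgressionJoined p q u v w) : ProgressionJoined q p u v w := by
  unfold ProgressionJoined at *; omega

theorem isAffineFive_of_mid {p q x y z : ℤ} (hpq : p + q = 2 * x) (hne : p ≠ q)
    (hxy : x ≠ y) (hxz : x ≠ z) (hyz : y ≠ z)
    (h : x + y = 2 * q ∨ x + z = 2 * q ∨ y + z = 2 * q)
    (hx : ProgressionJoined p q x y z) (hy : ProgressionJoined p q y x z) (hz : ProgressionJoined p q z x y) :
    IsAffineFive {p, q, x, y, z} := by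
  rcases h with h | h | h
  · exact isAffineFive_of_mid_left hpq hne hxz hyz h hz
  · rw [Set.pair_comm y z]
    exact isAffineFive_of_mid_left hpq hne hxy hyz.symm h hy
  · rcases hx with hx | hx | hx | hx | hx | hx
    · exact isAffineFive_of_mid_right hpq hne hxy hxz h (by omega)
    · exact isAffineFive_of_mid_right hpq hne hxy hxz h (by omega)
    · exact isAffineFive_of_mid_right hpq hne hxy hxz h (by omega)
    all_goals
      rw [Set.pair_comm y z]
      exact isAffineFive_of_mid_right hpq hne hxz hxy (by omega) (by omega)

theorem isAffineFive_of_joined {p q x y z : ℤ} (hne : p ≠ q)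
    (hxy : x ≠ y) (hxz : x ≠ z) (hyz : y ≠ z)
    (hpq : p + q = 2 * x ∨ p + q = 2 * y ∨ p + q = 2 * z)
    (h : (x + y = 2 * q ∨ x + z = 2 * q ∨ y + z = 2 * q) ∨
      (x + y = 2 * p ∨ x + z = 2 * p ∨ y + z = 2 * p))
    (hx : ProgressionJoined p q x y z) (hy : ProgressionJoined p q y x z) (hz : ProgressionJoined p q z x y) :
    IsAffineFive {p, q, x, y, z} := by
  wlog hq : x + y = 2 * q ∨ x + z = 2 * q ∨ y + z = 2 * q generalizing p q
  · rw [Set.insert_comm]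
    exact this hne.symm (by simpa only [add_comm q p] using hpq) h.symm hx.swap' hy.swap' hz.swap' (h.resolve_left hq)
  rcases hpq with hpq | hpq | hpq
  · exact isAffineFive_of_mid hpq hne hxy hxz hyz hq hx hy hz
  · rw [Set.insert_comm x y]
    exact isAffineFive_of_mid hpq hne hxy.symm hyz hxz (by clear h; omega) hy hx hz.swap
  · rw [Set.pair_comm y z, Set.insert_comm x z]
    exact isAffineFive_of_mid hpq hne hxz.symm hyz.symm hxy (by clear h; omega) hz hx.swap hy.swap

/-- A finite set of integers with two elements splits into two parts such that the ends of any
three-term progression in the set lie in the same part. -/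
theorem exists_parity (S : Set ℤ) {s₀ s₁ : ℤ} (h₀ : s₀ ∈ S) (h₁ : s₁ ∈ S) (hne : s₀ ≠ s₁) :
    ∃ E : ℤ → Prop, (∃ s ∈ S, E s) ∧ (∃ s ∈ S, ¬ E s) ∧
      ∀ a ∈ S, ∀ b ∈ S, ∀ c ∈ S, 2 * a = b + c → (E b ↔ E c) := by
  have hex : ∃ n : ℕ, ∃ s ∈ S, ¬ (2 : ℤ) ^ n ∣ s - s₀ := by
    -- The exponent `n = |s₁ - s₀|` works because `0 < n < 2 ^ n`.
    refine ⟨(s₁ - s₀).natAbs, s₁, h₁, fun hd => ?_⟩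
    have h2 := Int.natAbs_dvd_natAbs.2 hd
    rw [Int.natAbs_pow] at h2
    have h3 := Nat.le_of_dvd (by omega) h2
    have h4 : (s₁ - s₀).natAbs < 2 ^ (s₁ - s₀).natAbs := Nat.lt_two_pow_self
    norm_num at h3
    omega
  classical
  obtain ⟨s, hs, hns⟩ := Nat.find_spec hex
  have hmin : ∀ s ∈ S, (2 : ℤ) ^ (Nat.find hex - 1) ∣ s - s₀ := by
    by_contra hcon
    push Not at hcon
    have hpos : Nat.find hex ≠ 0 := by
      intro h0
      rw [h0] at hns
      simp at hns
    exact Nat.find_min hex (m := Nat.find hex - 1) (by omega) hcon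
  obtain ⟨n, hn⟩ : ∃ n, Nat.find hex = n + 1 := by
    refine Nat.exists_eq_succ_of_ne_zero fun h0 => ?_
    rw [h0] at hns
    simp at hns
  rw [hn] at hns hmin
  simp only [Nat.add_sub_cancel] at hmin
  refine ⟨fun s => (2 : ℤ) ^ (n + 1) ∣ s - s₀, ⟨s₀, h₀, by simp⟩, ⟨s, hs, hns⟩, ?_⟩
  intro a ha b _ c _ habc
  have hd : (2 : ℤ) ^ (n + 1) ∣ (b - s₀) + (c - s₀) := by
    obtain ⟨k, hk⟩ := hmin a ha
    exact ⟨k, by rw [pow_succ]; linear_combination 2 * hk - habc⟩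
  exact ⟨fun h => (dvd_add_right h).1 hd, fun h => (dvd_add_left h).1 hd⟩

/-- Linkedness at the pair puts the midpoint of `p, q` in the triple; at the triple, it makes `p` or
`q` the midpoint of two of `x, y, z`; at singletons, it joins each member of the triple to another
one. -/
theorem isAffineFive_of_two_three {S : Finset ℤ} (hS : ProgressionLinked (S : Set ℤ))
    {E : ℤ → Prop} [DecidablePred E]
    (hE : ∀ a ∈ S, ∀ b ∈ S, ∀ c ∈ S, 2 * a = b + c → (E b ↔ E c))
    (h2 : (S.filter E).card = 2) (h3 : (S.filter fun s => ¬ E s).card = 3) :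
    IsAffineFive (S : Set ℤ) := by
  obtain ⟨p, q, hne, hpq⟩ := Finset.card_eq_two.1 h2
  obtain ⟨x, y, z, hxy, hxz, hyz, hxyz⟩ := Finset.card_eq_three.1 h3
  have memE : ∀ s, (s ∈ S ∧ E s) ↔ (s = p ∨ s = q) := fun s => by
    rw [← Finset.mem_filter, hpq]; simp
  have memN : ∀ s, (s ∈ S ∧ ¬ E s) ↔ (s = x ∨ s = y ∨ s = z) := fun s => by
    rw [← Finset.mem_filter (p := fun s => ¬ E s), hxyz]; simp
  have mem : ∀ s, s ∈ S ↔ (s = p ∨ s = q ∨ s = x ∨ s = y ∨ s = z) := fun s => by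
    have := memE s; have := memN s; tauto
  have eS : (S : Set ℤ) = {p, q, x, y, z} := by
    ext s; simpa using mem s
  have hp := (memE p).2 (by simp)
  have hq := (memE q).2 (by simp)
  have hx := (memN x).2 (by simp)
  have hy := (memN y).2 (by simp)
  have hz := (memN z).2 (by simp)
  have sing : ∀ s ∈ S, ∃ a ∈ S, ∃ c ∈ S, 2 * a = s + c ∧ c ≠ s ∧ (E s ↔ E c) := by
    intro s hs
    obtain ⟨a, ha, b, hb, c, hc, habc, hbT, hT⟩ := hS {s} ⟨s, hs, rfl⟩ (by
      by_cases h : s = p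
      · exact ⟨q, hq.1, by simp [h, hne.symm]⟩
      · exact ⟨p, hp.1, by simpa using Ne.symm h⟩)
    obtain rfl : b = s := hbT
    refine ⟨a, ha, c, hc, habc, fun h => hT ?_, hE a ha b hb c hc habc⟩
    simp only [Set.mem_singleton_iff]
    omega
  have joined : ∀ u v w, u ∈ S → ¬ E u → (∀ s, (s ∈ S ∧ ¬ E s) ↔ (s = u ∨ s = v ∨ s = w)) →
      ProgressionJoined p q u v w := by
    intro u v w hu hEu huvw
    obtain ⟨a, ha, c, hc, habc, hcs, hEc⟩ := sing u hu
    have h1 := (huvw c).1 ⟨hc, fun h => hEu (hEc.2 h)⟩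
    have h2 : a = p ∨ a = q ∨ a = u ∨ a = v ∨ a = w := by
      have := memE a; have := huvw a; tauto
    unfold ProgressionJoined
    omega
  rw [eS]
  refine isAffineFive_of_joined hne hxy hxz hyz ?_ ?_ (joined x y z hx.1 hx.2 memN)
    (joined y x z hy.1 hy.2 fun s => (memN s).trans (by tauto))
    (joined z x y hz.1 hz.2 fun s => (memN s).trans (by tauto))
  · obtain ⟨a, ha, b, hb, c, hc, habc, hbT, hT⟩ := hS {s | E s} ⟨p, hp.1, hp.2⟩ ⟨x, hx.1, hx.2⟩
    have hEc := (hE a ha b hb c hc habc).1 hbT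
    have h1 := (memE b).1 ⟨hb, hbT⟩
    have h2 := (memE c).1 ⟨hc, hEc⟩
    have hEa : ¬ E a := fun h => hT ⟨h, hEc⟩
    have h3 := (memN a).1 ⟨ha, hEa⟩
    have hap : a ≠ p := by rintro rfl; exact hEa hp.2
    have haq : a ≠ q := by rintro rfl; exact hEa hq.2
    omega
  · obtain ⟨a, ha, b, hb, c, hc, habc, hbT, hT⟩ :=
      hS {s | ¬ E s} ⟨x, hx.1, hx.2⟩ ⟨p, hp.1, not_not.2 hp.2⟩
    have hEc : ¬ E c := fun h => hbT ((hE a ha b hb c hc habc).2 h)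
    have h1 := (memN b).1 ⟨hb, hbT⟩
    have h2 := (memN c).1 ⟨hc, hEc⟩
    have hEa : E a := by
      by_contra h
      exact hT ⟨h, hEc⟩
    have h3 := (memE a).1 ⟨ha, hEa⟩
    have hab : a ≠ b := by rintro rfl; exact hbT hEa
    omega

/-- A five-element progression-linked set of integers is an affine image of one of the seven
normalized sets. -/
theorem ProgressionLinked.isAffineFive {S : Set ℤ} (hS : ProgressionLinked S)
    (hcard : S.ncard = 5) : IsAffineFive S := by
  classical
  have hfin : S.Finite := Set.finite_of_ncard_ne_zero (by omega)
  lift S to Finset ℤ using hfin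
  rw [Set.ncard_coe_finset] at hcard
  obtain ⟨s₀, h₀, s₁, h₁, hne⟩ := Finset.one_lt_card.1 (by omega : 1 < S.card)
  obtain ⟨E, ⟨e, he, hEe⟩, ⟨f, hf, hEf⟩, hE⟩ := exists_parity (S : Set ℤ) h₀ h₁ hne
  have key : ∀ s ∈ S, ∃ c ∈ S, c ≠ s ∧ (E s ↔ E c) := by
    intro s hs
    obtain ⟨a, ha, b, hb, c, hc, habc, hbT, hT⟩ := hS {s} ⟨s, hs, rfl⟩ (by
      by_cases h : s = e
      · exact ⟨f, hf, by rintro rfl; exact hEf (h ▸ hEe)⟩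
      · exact ⟨e, he, by simpa using Ne.symm h⟩)
    obtain rfl : b = s := hbT
    refine ⟨c, hc, fun h => hT ?_, hE a ha b hb c hc habc⟩
    simp only [Set.mem_singleton_iff]
    omega
  have two_le : 1 < (S.filter E).card := by
    obtain ⟨c, hc, hce, hEc⟩ := key e he
    exact Finset.one_lt_card.2 ⟨c, Finset.mem_filter.2 ⟨hc, hEc.1 hEe⟩, e,
      Finset.mem_filter.2 ⟨he, hEe⟩, hce⟩
  have two_le' : 1 < (S.filter fun s => ¬ E s).card := by
    obtain ⟨c, hc, hcf, hEc⟩ := key f hf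
    exact Finset.one_lt_card.2 ⟨c, Finset.mem_filter.2 ⟨hc, fun h => hEf (hEc.2 h)⟩, f,
      Finset.mem_filter.2 ⟨hf, hEf⟩, hcf⟩
  have hsum := Finset.card_filter_add_card_filter_not (s := S) E
  obtain h | h : (S.filter E).card = 2 ∨ (S.filter E).card = 3 := by omega
  · exact isAffineFive_of_two_three hS hE h (by omega)
  · refine isAffineFive_of_two_three hS (E := fun s => ¬ E s)
      (fun a ha b hb c hc habc => not_congr (hE a ha b hb c hc habc)) (by omega) ?_
    simpa using h

/-! ### Separating links by graphs -/

namespace KnotTheory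

/-- The composition of two ambient isotopies. -/
def AmbientIsotopy.comp (G H : AmbientIsotopy) : AmbientIsotopy where
  toFun t x := G.toFun t (H.toFun t x)
  invFun t x := H.invFun t (G.invFun t x)
  smooth_toFun := G.smooth_toFun.comp (contDiff_fst.prodMk H.smooth_toFun)
  smooth_invFun := H.smooth_invFun.comp (contDiff_fst.prodMk G.smooth_invFun)
  left_inv t x := by rw [G.left_inv, H.left_inv]
  right_inv t x := by rw [H.right_inv, G.right_inv]
  at_zero x := by rw [H.at_zero, G.at_zero]

/-- The vertical ambient isotopy that moves the graph of `f` to the horizontal plane. -/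
def AmbientIsotopy.lowerGraph (f : ℝ × ℝ → ℝ) (hf : ContDiff ℝ ∞ f) : AmbientIsotopy where
  toFun t p := (p.1, p.2 - t * f p.1)
  invFun t p := (p.1, p.2 + t * f p.1)
  smooth_toFun := by fun_prop
  smooth_invFun := by fun_prop
  left_inv t p := by simp
  right_inv t p := by simp
  at_zero p := by simp

/-- A compact set lying above another one is separated from it by a constant near each fiber of the
vertical projection. -/
theorem exists_const_separating {A B : Set Space} (hA : IsCompact A) (hB : IsCompact B)
    (h : ∀ a ∈ A, ∀ b ∈ B, a.1 = b.1 → b.2 < a.2) (x : ℝ × ℝ) :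
    ∃ c : ℝ, ∀ᶠ y in 𝓝 x, (∀ a ∈ A, a.1 = y → c < a.2) ∧ ∀ b ∈ B, b.1 = y → b.2 < c := by
  have fiber : ∀ {C : Set Space}, IsCompact C → IsCompact (Prod.snd '' (C ∩ {p | p.1 = x})) :=
    fun hC => (hC.inter_right (isClosed_eq continuous_fst continuous_const)).image continuous_snd
  obtain ⟨c, hcA, hcB⟩ : ∃ c : ℝ, (∀ a ∈ A, a.1 = x → c < a.2) ∧ ∀ b ∈ B, b.1 = x → b.2 < c := by
    rcases (Prod.snd '' (A ∩ {p | p.1 = x})).eq_empty_or_nonempty with hAx | hAx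
    · obtain ⟨M, hM⟩ := (fiber hB).bddAbove
      refine ⟨M + 1, fun a ha hax => ?_, fun b hb hbx => ?_⟩
      · exact absurd (Set.mem_image_of_mem Prod.snd (⟨ha, hax⟩ : a ∈ A ∩ {p | p.1 = x}))
          (by rw [hAx]; exact Set.notMem_empty _)
      · exact (hM ⟨b, ⟨hb, hbx⟩, rfl⟩).trans_lt (lt_add_one M)
    · obtain ⟨_, ⟨a, ⟨ha, hax⟩, rfl⟩, hmin⟩ := (fiber hA).exists_isLeast hAx
      rcases (Prod.snd '' (B ∩ {p | p.1 = x})).eq_empty_or_nonempty with hBx | hBx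
      · refine ⟨a.2 - 1, fun a' ha' hax' => ?_, fun b hb hbx => ?_⟩
        · exact (sub_one_lt _).trans_le (hmin ⟨a', ⟨ha', hax'⟩, rfl⟩)
        · exact absurd (Set.mem_image_of_mem Prod.snd (⟨hb, hbx⟩ : b ∈ B ∩ {p | p.1 = x}))
            (by rw [hBx]; exact Set.notMem_empty _)
      · obtain ⟨_, ⟨b, ⟨hb, hbx⟩, rfl⟩, hmax⟩ := (fiber hB).exists_isGreatest hBx
        obtain ⟨c, hbc, hca⟩ := exists_between (h a ha b hb (hax.trans hbx.symm))
        exact ⟨c, fun a' ha' hax' => hca.trans_le (hmin ⟨a', ⟨ha', hax'⟩, rfl⟩),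
          fun b' hb' hbx' => (hmax ⟨b', ⟨hb', hbx'⟩, rfl⟩).trans_lt hbc⟩
  refine ⟨c, ?_⟩
  have hA' : IsClosed (Prod.fst '' (A ∩ {p | p.2 ≤ c})) :=
    ((hA.inter_right (isClosed_le continuous_snd continuous_const)).image continuous_fst).isClosed
  have hB' : IsClosed (Prod.fst '' (B ∩ {p | c ≤ p.2})) :=
    ((hB.inter_right (isClosed_le continuous_const continuous_snd)).image continuous_fst).isClosed
  have hxA : x ∉ Prod.fst '' (A ∩ {p | p.2 ≤ c}) := by
    rintro ⟨a, ⟨ha, hac⟩, hax⟩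
    exact absurd (hcA a ha hax) (not_lt.2 hac)
  have hxB : x ∉ Prod.fst '' (B ∩ {p | c ≤ p.2}) := by
    rintro ⟨b, ⟨hb, hbc⟩, hbx⟩
    exact absurd (hcB b hb hbx) (not_lt.2 hbc)
  filter_upwards [hA'.isOpen_compl.mem_nhds hxA, hB'.isOpen_compl.mem_nhds hxB] with y hyA hyB
  exact ⟨fun a ha hay => not_le.1 fun hac => hyA ⟨a, ⟨ha, hac⟩, hay⟩,
    fun b hb hby => not_le.1 fun hbc => hyB ⟨b, ⟨hb, hbc⟩, hby⟩⟩

/-- A compact set lying above another one is separated from it by the graph of a smooth function. -/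
theorem exists_contDiff_separating {A B : Set Space} (hA : IsCompact A) (hB : IsCompact B)
    (h : ∀ a ∈ A, ∀ b ∈ B, a.1 = b.1 → b.2 < a.2) :
    ∃ f : ℝ × ℝ → ℝ, ContDiff ℝ ∞ f ∧ (∀ a ∈ A, f a.1 < a.2) ∧ ∀ b ∈ B, b.2 < f b.1 := by
  -- The admissible heights over each point form an interval, so a smooth partition of unity glues
  -- the local constants.
  obtain ⟨g, hg⟩ := exists_contMDiffMap_forall_mem_convex_of_local_const (n := ⊤)
    (modelWithCornersSelf ℝ (ℝ × ℝ))
    (t := fun y => {c : ℝ | (∀ a ∈ A, a.1 = y → c < a.2) ∧ ∀ b ∈ B, b.1 = y → b.2 < c})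
    (fun y => by
      refine Set.OrdConnected.convex ⟨fun c hc d hd e he => ⟨fun a ha hay => ?_, fun b hb hby => ?_⟩⟩
      · exact he.2.trans_lt (hd.1 a ha hay)
      · exact (hc.2 b hb hby).trans_le he.1)
    (exists_const_separating hA hB h)
  exact ⟨g, g.contMDiff.contDiff, fun a ha => (hg a.1).1 a ha rfl, fun b hb => (hg b.1).2 b hb rfl⟩

namespace Link

theorem continuous_curve (K : Link) (i : Fin K.numComp) : Continuous (K.curve i) :=
  (K.smooth i).continuous

theorem curve_mem_carrier (K : Link) (i : Fin K.numComp) (t : ℝ) : K.curve i t ∈ K.carrier :=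
  ⟨i, t, rfl⟩

theorem isCompact_range_curve (K : Link) (i : Fin K.numComp) : IsCompact (Set.range (K.curve i)) := by
  rw [← Function.Periodic.image_Icc (K.periodic i) one_pos 0]
  exact isCompact_Icc.image (K.continuous_curve i)

theorem Isotopic.splittable {L K : Link} (h : L.Isotopic K) (hK : K.Splittable) :
    L.Splittable := by
  obtain ⟨H, hH⟩ := h
  obtain ⟨G, h0, ⟨p, hp, hpos⟩, ⟨q, hq, hneg⟩⟩ := hK
  rw [← hH] at hp hq
  obtain ⟨p, hp, rfl⟩ := hp
  obtain ⟨q, hq, rfl⟩ := hq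
  exact ⟨G.comp H, fun r hr => h0 _ (hH ▸ Set.mem_image_of_mem _ hr), ⟨p, hp, hpos⟩, q, hq, hneg⟩

/-- A link is splittable if some, but not all, of its components pass above all others. -/
theorem splittable_of_above (K : Link) (P : Fin K.numComp → Prop) {i₀ j₀ : Fin K.numComp}
    (hi₀ : P i₀) (hj₀ : ¬ P j₀)
    (h : ∀ i j s t, P i → ¬ P j → (K.curve i s).1 = (K.curve j t).1 →
      (K.curve j t).2 < (K.curve i s).2) : K.Splittable := by
  have compact : ∀ Q : Fin K.numComp → Prop,
      IsCompact (⋃ i ∈ {i | Q i}, Set.range (K.curve i)) := fun Q =>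
    (Set.toFinite {i | Q i}).isCompact_biUnion fun i _ => K.isCompact_range_curve i
  obtain ⟨f, hf, hA, hB⟩ := exists_contDiff_separating (compact P) (compact fun i => ¬ P i) (by
    intro a ha b hb hab
    simp only [Set.mem_iUnion] at ha hb
    obtain ⟨i, hi, s, rfl⟩ := ha
    obtain ⟨j, hj, t, rfl⟩ := hb
    exact h i j s t hi hj hab)
  have hA' : ∀ i t, P i → f (K.curve i t).1 < (K.curve i t).2 := fun i t hi =>
    hA _ (Set.mem_biUnion (show i ∈ {i | _} from hi) ⟨t, rfl⟩)
  have hB' : ∀ i t, ¬ P i → (K.curve i t).2 < f (K.curve i t).1 := fun i t hi =>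
    hB _ (Set.mem_biUnion (show i ∈ {i | _} from hi) ⟨t, rfl⟩)
  refine ⟨AmbientIsotopy.lowerGraph f hf, ?_, ⟨_, K.curve_mem_carrier i₀ 0, ?_⟩,
    _, K.curve_mem_carrier j₀ 0, ?_⟩
  · rintro _ ⟨i, t, rfl⟩
    by_cases hi : P i
    · simpa [AmbientIsotopy.lowerGraph, sub_eq_zero] using (hA' i t hi).ne'
    · simpa [AmbientIsotopy.lowerGraph, sub_eq_zero] using (hB' i t hi).ne
  · simpa [AmbientIsotopy.lowerGraph] using hA' i₀ 0 hi₀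
  · simpa [AmbientIsotopy.lowerGraph] using hB' j₀ 0 hj₀

/-! ### Arcs along a component -/

theorem eventually_notMem_under {K : Link} (hK : K.IsRegular) (i : Fin K.numComp) (t : ℝ) :
    ∀ᶠ s in 𝓝[≠] t, K.curve i s ∉ K.under := by
  have h : ∀ᶠ s in 𝓝[≠] t, ∀ u ∈ K.under, K.curve i s ≠ u := by
    rw [Filter.eventually_all_finite hK.finite_crossings]
    intro u _
    by_cases hu : K.curve i t = u
    · have hI : Set.Ioo (t - 1) (t + 1) ∈ 𝓝[≠] t :=
        mem_nhdsWithin_of_mem_nhds (Ioo_mem_nhds (by linarith) (by linarith))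
      filter_upwards [hI, self_mem_nhdsWithin] with s hs hst hsu
      obtain ⟨-, k, hk⟩ := K.injective i i s t (hsu.trans hu.symm)
      have h1 : (k : ℝ) < 1 := by linarith [hs.2]
      have h2 : (-1 : ℝ) < k := by linarith [hs.1]
      have h3 : k = 0 := by
        have h1' : k < 1 := by exact_mod_cast h1
        have h2' : -1 < k := by exact_mod_cast h2
        omega
      exact hst (by simpa [h3] using hk)
    · exact ((K.continuous_curve i).continuousAt.eventually_ne hu).filter_mono nhdsWithin_le_nhds
  filter_upwards [h] with s hs hmem using hs _ hmem rfl

theorem arcOf_eq_of_isPreconnected (K : Link) (i : Fin K.numComp) {I : Set ℝ}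
    (hI : IsPreconnected I) (hcut : ∀ s ∈ I, K.curve i s ∈ K.carrier \ K.under) {s t : ℝ}
    (hs : s ∈ I) (ht : t ∈ I) :
    K.arcOf ⟨K.curve i s, hcut s hs⟩ = K.arcOf ⟨K.curve i t, hcut t ht⟩ := by
  have : PreconnectedSpace I := isPreconnected_iff_preconnectedSpace.1 hI
  let f : I → K.Cut := fun s => ⟨K.curve i s, hcut s s.2⟩
  have hf : Continuous f :=
    ((K.continuous_curve i).comp continuous_subtype_val).subtype_mk _
  exact ConnectedComponents.coe_eq_coe'.2
    ((isPreconnected_range hf).subset_connectedComponent ⟨⟨t, ht⟩, rfl⟩ ⟨⟨s, hs⟩, rfl⟩)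

theorem exists_isArcAfter {K : Link} (hK : K.IsRegular) (i : Fin K.numComp) (t : ℝ) :
    ∃ a, K.IsArcAfter i t a := by
  obtain ⟨u, hu, h⟩ := mem_nhdsGT_iff_exists_Ioo_subset.1
    ((eventually_notMem_under hK i t).filter_mono (nhdsWithin_mono t fun s hs => ne_of_gt hs))
  have hcut : ∀ s ∈ Set.Ioo t u, K.curve i s ∈ K.carrier \ K.under := fun s hs =>
    ⟨K.curve_mem_carrier i s, h hs⟩
  obtain ⟨m, hm⟩ := exists_between (Set.mem_Ioi.1 hu)
  refine ⟨K.arcOf ⟨_, hcut m hm⟩, ?_⟩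
  filter_upwards [Ioo_mem_nhdsGT (Set.mem_Ioi.1 hu)] with s hs
  exact ⟨hcut s hs, K.arcOf_eq_of_isPreconnected i isPreconnected_Ioo hcut hs hm⟩

theorem exists_isArcBefore {K : Link} (hK : K.IsRegular) (i : Fin K.numComp) (t : ℝ) :
    ∃ a, K.IsArcBefore i t a := by
  obtain ⟨u, hu, h⟩ := mem_nhdsLT_iff_exists_Ioo_subset.1
    ((eventually_notMem_under hK i t).filter_mono (nhdsWithin_mono t fun s hs => ne_of_lt hs))
  have hcut : ∀ s ∈ Set.Ioo u t, K.curve i s ∈ K.carrier \ K.under := fun s hs =>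
    ⟨K.curve_mem_carrier i s, h hs⟩
  obtain ⟨m, hm⟩ := exists_between (Set.mem_Iio.1 hu)
  refine ⟨K.arcOf ⟨_, hcut m hm⟩, ?_⟩
  filter_upwards [Ioo_mem_nhdsLT (Set.mem_Iio.1 hu)] with s hs
  exact ⟨hcut s hs, K.arcOf_eq_of_isPreconnected i isPreconnected_Ioo hcut hs hm⟩

/-- Away from the lower points of crossings the arcs before and after agree with the arc through
the point. -/
theorem eventually_arcOf_eq {K : Link} (hK : K.IsRegular) (i : Fin K.numComp) (t : ℝ)
    (ht : K.curve i t ∈ K.carrier \ K.under) :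
    ∀ᶠ s in 𝓝 t, ∃ h : K.curve i s ∈ K.carrier \ K.under,
      K.arcOf ⟨K.curve i s, h⟩ = K.arcOf ⟨K.curve i t, ht⟩ := by
  have h : ∀ᶠ s in 𝓝 t, K.curve i s ∉ K.under :=
    (K.continuous_curve i).continuousAt (hK.finite_crossings.isClosed.isOpen_compl.mem_nhds ht.2)
  obtain ⟨l, u, htm, hsub⟩ := mem_nhds_iff_exists_Ioo_subset.1 h
  have hcut : ∀ s ∈ Set.Ioo l u, K.curve i s ∈ K.carrier \ K.under := fun s hs =>
    ⟨K.curve_mem_carrier i s, hsub hs⟩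
  filter_upwards [Ioo_mem_nhds htm.1 htm.2] with s hs
  exact ⟨hcut s hs, K.arcOf_eq_of_isPreconnected i isPreconnected_Ioo hcut hs htm⟩

/-- A strand above `q` would create a triple point. -/
theorem exists_cut_above {K : Link} (hK : K.IsRegular) {p q : Space} (hp : p ∈ K.carrier)
    (hq : q ∈ K.carrier) (hqp : q.1 = p.1) (hlt : p.2 < q.2) : q ∈ K.carrier \ K.under := by
  refine ⟨hq, ?_⟩
  rintro ⟨-, r, hr, hrq, hqr⟩
  rcases hK.no_triple p hp q hq r hr hqp.symm hrq.symm with h | h | h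
  · exact hlt.ne (by rw [h])
  · exact hqr.ne (by rw [h])
  · exact (hlt.trans hqr).ne (by rw [h])

/-- If no crossing takes the arcs of the set `U` to arcs outside of it, then each component
of the link is either entirely in `U` or entirely outside. -/
theorem mem_iff_mem_of_component {K : Link} (hK : K.IsRegular) {U : Set K.Arc}
    (hU : ∀ i t, K.curve i t ∈ K.under → ∀ b c, K.IsArcBefore i t b → K.IsArcAfter i t c →
      (b ∈ U ↔ c ∈ U)) (i : Fin K.numComp) {s t : ℝ}
    (hs : K.curve i s ∈ K.carrier \ K.under) (ht : K.curve i t ∈ K.carrier \ K.under) :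
    K.arcOf ⟨_, hs⟩ ∈ U ↔ K.arcOf ⟨_, ht⟩ ∈ U := by
  choose after hafter using fun t => exists_isArcAfter hK i t
  have key : ∀ t, ∀ᶠ s in 𝓝 t, ∀ h : K.curve i s ∈ K.carrier \ K.under,
      (K.arcOf ⟨_, h⟩ ∈ U ↔ after t ∈ U) := by
    intro t
    obtain ⟨b, hb⟩ := exists_isArcBefore hK i t
    have hba : b ∈ U ↔ after t ∈ U := by
      by_cases hu : K.curve i t ∈ K.under
      · exact hU i t hu b _ hb (hafter t)
      · have he := eventually_arcOf_eq hK i t ⟨K.curve_mem_carrier i t, hu⟩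
        obtain ⟨r, ⟨_, e₁⟩, _, e₂⟩ := (hb.and (he.filter_mono nhdsWithin_le_nhds)).exists
        obtain ⟨r', ⟨_, e₃⟩, _, e₄⟩ := ((hafter t).and (he.filter_mono nhdsWithin_le_nhds)).exists
        rw [← e₁, e₂, ← e₃, e₄]
    have hself : ∀ h : K.curve i t ∈ K.carrier \ K.under,
        (K.arcOf ⟨_, h⟩ ∈ U ↔ after t ∈ U) := by
      intro h
      obtain ⟨r, ⟨_, e₁⟩, _, e₂⟩ := ((hafter t).and
        ((eventually_arcOf_eq hK i t h).filter_mono nhdsWithin_le_nhds)).exists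
      rw [← e₁, e₂]
    rw [← nhdsNE_sup_pure, ← nhdsLT_sup_nhdsGT, Filter.eventually_sup, Filter.eventually_sup]
    refine ⟨⟨?_, ?_⟩, hself⟩
    · filter_upwards [hb] with r ⟨_, e⟩ _
      rw [e, hba]
    · filter_upwards [hafter t] with r ⟨_, e⟩ _
      rw [e]
  -- `after` is defined at crossings too, so connectedness of `ℝ` applies.
  have hloc : IsLocallyConstant fun t => after t ∈ U := by
    rw [IsLocallyConstant.iff_eventually_eq]
    intro t
    filter_upwards [(key t).eventually_nhds] with s hs
    obtain ⟨r, ⟨h, e⟩, hr⟩ := ((hafter s).and (hs.filter_mono nhdsWithin_le_nhds)).exists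
    rw [← e]
    exact propext (hr h)
  exact ((key s).self_of_nhds hs).trans
    ((iff_of_eq (hloc.apply_eq_of_preconnectedSpace s t)).trans ((key t).self_of_nhds ht).symm)

end Link
end KnotTheory

/-! ### Colorings of non-splittable links -/

namespace KnotTheory
namespace Link

/-- The colors of a diagram of a non-splittable link are linked by progressions. -/
theorem IsZColoring.progressionLinked {K : Link} (hK : K.IsRegular) (hns : ¬ K.Splittable)
    {γ : K.Arc → ℤ} (hγ : K.IsZColoring γ) : ProgressionLinked (Set.range γ) := by
  rintro T ⟨_, ⟨a₀, rfl⟩, ha₀⟩ ⟨_, ⟨b₀, rfl⟩, hb₀⟩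
  by_contra hcon
  have hT : ∀ a b c, 2 * γ a = γ b + γ c → γ b ∈ T → γ a ∈ T ∧ γ c ∈ T := by
    intro a b c habc hb
    by_contra h
    exact hcon ⟨_, ⟨a, rfl⟩, _, ⟨b, rfl⟩, _, ⟨c, rfl⟩, habc, hb, h⟩
  have crossing : ∀ i t, ∀ q : K.Cut, (q : Space).1 = (K.curve i t).1 →
      (K.curve i t).2 < (q : Space).2 → ∀ b c, K.IsArcBefore i t b → K.IsArcAfter i t c →
      (γ b ∈ T ↔ γ c ∈ T) ∧ (γ b ∈ T → γ (K.arcOf q) ∈ T) := by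
    intro i t q hq hlt b c hb hc
    have h := hγ i t q hq hlt b c hb hc
    exact ⟨⟨fun hb' => (hT _ _ _ h hb').2, fun hc' => (hT _ _ _ (h.trans (add_comm _ _)) hc').2⟩,
      fun hb' => (hT _ _ _ h hb').1⟩
  have comp := fun i s t => mem_iff_mem_of_component hK (U := γ ⁻¹' T) (i := i) (s := s) (t := t) (by
    rintro i t ⟨hp, q, hq, hqp, hlt⟩ b c hb hc
    exact (crossing i t ⟨q, exists_cut_above hK hp hq hqp hlt⟩ hqp hlt b c hb hc).1)
  -- a component is in `P` if its arcs have colors in `T`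
  let P : Fin K.numComp → Prop := fun i =>
    ∃ s, ∃ h : K.curve i s ∈ K.carrier \ K.under, γ (K.arcOf ⟨_, h⟩) ∈ T
  have hP : ∀ i t (h : K.curve i t ∈ K.carrier \ K.under),
      P i ↔ γ (K.arcOf ⟨_, h⟩) ∈ T := fun i t h =>
    ⟨fun ⟨s, hs, hsT⟩ => (comp i s t hs h).1 hsT, fun hT => ⟨t, h, hT⟩⟩
  have exists_index : ∀ a : K.Arc, ∃ i, P i ↔ γ a ∈ T := by
    intro a
    obtain ⟨⟨_, ⟨i, t, rfl⟩, hu⟩, rfl⟩ := ConnectedComponents.surjective_coe a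
    exact ⟨i, hP i t ⟨⟨i, t, rfl⟩, hu⟩⟩
  obtain ⟨i₀, hi₀⟩ := exists_index a₀
  obtain ⟨j₀, hj₀⟩ := exists_index b₀
  refine hns (K.splittable_of_above P (hi₀.2 ha₀) (mt hj₀.1 hb₀) ?_)
  intro i j s t hi hj hij
  -- Equal heights would identify the components; if `i` ran below `j`, its under arc colored in `T`
  -- would force the over arc's color into `T`.
  rcases lt_trichotomy (K.curve j t).2 (K.curve i s).2 with hlt | heq | hlt
  · exact hlt
  · obtain ⟨rfl, -⟩ := K.injective i j s t (Prod.ext hij heq.symm)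
    exact absurd hi hj
  · have hcut := exists_cut_above hK (K.curve_mem_carrier i s) (K.curve_mem_carrier j t) hij.symm hlt
    obtain ⟨b, hb⟩ := exists_isArcBefore hK i s
    obtain ⟨c, hc⟩ := exists_isArcAfter hK i s
    have hbT : γ b ∈ T := by
      obtain ⟨r, h, e⟩ := hb.exists
      rw [← e]
      exact (hP i r h).1 hi
    exact absurd ((hP j t hcut).2 ((crossing i s ⟨_, hcut⟩ hij.symm hlt b c hb hc).2 hbT)) hj

theorem IsZColoring.of_affine {K : Link} {γ γ' : K.Arc → ℤ} (hγ : K.IsZColoring γ) {m k : ℤ}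
    (hk : k ≠ 0) (h : ∀ a, γ a = m + k * γ' a) : K.IsZColoring γ' := by
  intro i t q hq hlt b c hb hc
  have := hγ i t q hq hlt b c hb hc
  rw [h, h, h] at this
  exact mul_left_cancel₀ hk (by linear_combination this)

theorem AdmitsZColoring.of_affine {L : Link} {S : Set ℤ} {m k : ℤ} (hk : k ≠ 0)
    (h : L.AdmitsZColoring ((fun j => m + k * j) '' S)) : L.AdmitsZColoring S := by
  obtain ⟨K, hKL, γ, hγ, hrange⟩ := h
  have hmem : ∀ a, ∃ j ∈ S, m + k * j = γ a := fun a => by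
    have : γ a ∈ Set.range γ := ⟨a, rfl⟩
    rwa [hrange] at this
  choose γ' hγ'S hγ' using hmem
  refine ⟨K, hKL, γ', hγ.of_affine hk fun a => (hγ' a).symm, Set.Subset.antisymm ?_ ?_⟩
  · rintro _ ⟨a, rfl⟩
    exact hγ'S a
  · intro j hj
    obtain ⟨a, ha⟩ : m + k * j ∈ Set.range γ := hrange ▸ ⟨j, hj, rfl⟩
    exact ⟨a, mul_left_cancel₀ hk (add_left_cancel ((hγ' a).trans ha))⟩

end Link
end KnotTheory

theorem theorem5p1 (L : KnotTheory.Link) (hL : ¬ L.Splittable)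
    (hcol : ∃ S : Set ℤ, S.ncard = 5 ∧ L.AdmitsZColoring S) :
    ∃ S : Set ℤ, L.AdmitsZColoring S ∧
      (S = {0, 1, 2, 3, 4} ∨ S = {0, 1, 2, 3, 5} ∨ S = {0, 1, 2, 3, 6} ∨ S = {0, 1, 2, 4, 7} ∨
        S = {0, 2, 3, 4, 5} ∨ S = {0, 3, 4, 5, 6} ∨ S = {0, 3, 5, 6, 7}) := by
  obtain ⟨S, hcard, hS⟩ := hcol
  obtain ⟨K, ⟨hK, hLK⟩, γ, hγ, rfl⟩ := hS
  have hlinked := hγ.progressionLinked hK fun h => hL (hLK.splittable h)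
  obtain ⟨m, k, hk, S₀, hS₀, hrange⟩ := hlinked.isAffineFive hcard
  refine ⟨S₀, KnotTheory.Link.AdmitsZColoring.of_affine (m := m) hk ?_, hS₀⟩
  rw [← hrange]
  exact ⟨K, ⟨hK, hLK⟩, γ, hγ, rfl⟩
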